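/- Throughout, $\log=\log_2$. Let $n\ge 1$. For distributions $P,Q$ over $\{0,1\}^n$ let $d(P,Q)$ be the earth mover's distance, $d(P,Q)=\min_T \mathrm{E}_{(u,v)\sim T}[d_H(u,v)]$, where $T$ ranges over the couplings of $P$ and $Q$ and $d_H$ is the normalized Hamming distance on $\{0,1\}^n$. Let $\mathcal S_m$ be the set of distributions over $\{0,1\}^n$ supported by at most $m$ elements, and let $d(P,\mathcal S_m)=\min_{Q\in\mathcal S_m}d(P,Q)$. A non-adaptive algorithm in the Huge Object model takes a number of independent samples of an unknown input distribution $P$ over $\{0,1\}^n$; from its coin tosses alone it fixes a set of queries $(i,j)$ (coordinate $j$ of sample $i$), receives all answers in bulk, and accepts or rejects depending only on its coins and the answers. It is a one-sided $\varepsilon$-test of $\mathcal S_m$ if it accepts every $P\in\mathcal S_m$ with probability $1$ and rejects every $P$ with $d(P,\mathcal S_m)>\varepsilon$ with probability greater than $2/3$. For integers $m\ge2$ and $0<\varepsilon\le 1$, let $t=\lceil\log\varepsilon^{-1}\rceil$ and consider the following non-adaptive algorithm $\mathcal A_{n,m,\varepsilon}$. 1. Choose indices $i_1,\dots,i_{\lceil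 2^{t+2}\log(m+1)\rceil}\in\{1,\dots,n\}$ uniformly and independently (with repetitions), and let $I_a=\{i_1,\dots,i_{\lceil 2^{a+2}\log(m+1)\rceil}\}$ for $0\le a\le t$. 2. Take a sample $u$ and query it at all indices of $I_t$. 3. For every $1\le k\le 2m$ and $0\le a\le t$, take a sequence $S_{a,k}$ of $2^{3-a}\cdot 2^{t}$ new samples and query each of them at all indices of $I_a$. 4. Reject if and only if there is a distinguishable composition of length $m+1$: a sequence $u_1=u,u_2,\dots,u_{m+1}$ with $u_i\in S_{a_i,k_i}$ for $2\le i\le m+1$ (for some $0\le a_i\le t$, $1\le k_i\le 2m$) such that, with $a_1=t$, for every $1\le i<i'\le m+1$ there is an index $j\in I_{a_i}\cap I_{a_{i'}}$ with $(u_i)_j\ne(u_{i'})_j$. **Theorem.** There is an absolute constant $C>0$ such that for all integers $n\ge1$, $m\ge 2$ and every real $0<\varepsilon\le1$, the algorithm $\mathcal A_{n,m,\varepsilon}$ is a one-sided $\varepsilon$-test of $\mathcal S_m$, and for every outcome of its coin tosses it makes at most $$C\cdot\varepsilon^{-1}\cdot\max\{1,\log\varepsilon^{-1}\}\cdot m\log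 m$$ queries. In particular it makes $O(\varepsilon^{-1}\log\varepsilon^{-1}\cdot m\log m)$ queries for $\varepsilon\le 1/2$. -/

import Mathlib

noncomputable section

namespace HugeObject

/-! ### Distributions over finite sets, distances and properties -/

/-- Binary strings of length `n`. -/
abbrev BitString (n : ℕ) : Type := Fin n → Bool

/-- Probability distributions over a finite set: nonnegative vectors with total mass one. For such a `P`,
the probability of the element `x` is `P x`. -/
abbrev FinDist (Ω : Type) [Fintype Ω] : Type := stdSimplex ℝ Ω

/-- Normalized Hamming distance between strings. -/
def stringDist {n : ℕ} (u v : BitString n) : ℝ := (hammingDist u v : ℝ) / n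

/-- Transfer distributions (couplings) from `P` to `Q`. -/
def transferDistributions {Ω₁ Ω₂ : Type} [Fintype Ω₁] [Fintype Ω₂]
    (P : FinDist Ω₁) (Q : FinDist Ω₂) : Set (FinDist (Ω₁ × Ω₂)) :=
  {T | (∀ a, ∑ b, T (a, b) = P a) ∧
       (∀ b, ∑ a, T (a, b) = Q b)}

/-- Earth mover's distance with respect to the normalized Hamming distance. The infimum is over
a nonempty compact set, so it is a minimum. -/
def earthMoverDist {n : ℕ} (P Q : FinDist (BitString n)) : ℝ :=
  ⨅ T : transferDistributions P Q,
    ∑ p : BitString n × BitString n, T.1 p * stringDist p.1 p.2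

/-- Distance of a distribution from a set of distributions (a property at string length `n`). -/
def distToProperty {n : ℕ} (P : FinDist (BitString n)) (𝓟 : Set (FinDist (BitString n))) : ℝ :=
  ⨅ Q : 𝓟, earthMoverDist P Q.1

/-- The bounded support property `S_m` at string length `n`: distributions over `{0,1}^n` that are
supported by at most `m` elements. -/
def boundedSupport (n m : ℕ) : Set (FinDist (BitString n)) :=
  {P | {x | P x ≠ 0}.ncard ≤ m}

/-! ### Non-adaptive algorithms in the Huge Object model -/

/-- A non-adaptive probabilistic algorithm whose input is a distribution over `{0,1}^n`. Its coin
tosses determine the query set (pairs of a sample and a coordinate) and the set of accepted answer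
vectors; the algorithm learns nothing about the samples apart from the answers to its queries. -/
structure NonAdaptiveAlgorithm (n : ℕ) where
  /-- Outcomes of the internal coin tosses. -/
  Coins : Type
  [fintypeCoins : Fintype Coins]
  /-- Law of the internal coin tosses. -/
  law : FinDist Coins
  /-- Index set of the samples that are taken. -/
  Sample : Type
  [fintypeSample : Fintype Sample]
  [decidableEqSample : DecidableEq Sample]
  /-- The set of queries. -/
  queries : Coins → Finset (Sample × Fin n)
  /-- The set of accepted answer vectors. -/
  accepted : (c : Coins) → Set (queries c → Bool)

attribute [instance] NonAdaptiveAlgorithm.fintypeCoins NonAdaptiveAlgorithm.fintypeSample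
  NonAdaptiveAlgorithm.decidableEqSample

namespace NonAdaptiveAlgorithm

variable {n : ℕ} (T : NonAdaptiveAlgorithm n)

/-- The answers to the queries, when the sampled strings are the rows of the matrix `M`. -/
def answers (c : T.Coins) (M : T.Sample → BitString n) : T.queries c → Bool :=
  fun q => M q.1.1 q.1.2

/-- Probability of an event that depends on the coin tosses and on the samples, which are drawn
independently from `P` and independently of the coins. -/
def runProb (P : FinDist (BitString n)) (E : T.Coins → (T.Sample → BitString n) → Prop) : ℝ :=
  open Classical in
  ∑ c : T.Coins, ∑ M : T.Sample → BitString n,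
    if E c M then T.law c * ∏ i, P (M i) else 0

/-- Probability that the algorithm accepts the input `P`. -/
def acceptProb (P : FinDist (BitString n)) : ℝ :=
  T.runProb P fun c M => T.answers c M ∈ T.accepted c

/-- Probability that the algorithm rejects the input `P`. -/
def rejectProb (P : FinDist (BitString n)) : ℝ :=
  T.runProb P fun c M => T.answers c M ∉ T.accepted c

/-- The algorithm is an `ε`-test for the property `𝓟`. -/
def IsTest (ε : ℝ) (𝓟 : Set (FinDist (BitString n))) : Prop :=
  (∀ P ∈ 𝓟, 2 / 3 < T.acceptProb P) ∧
  (∀ P : FinDist (BitString n), ε < distToProperty P 𝓟 → 2 / 3 < T.rejectProb P)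

/-- The algorithm is a one-sided `ε`-test for the property `𝓟`. -/
def IsOneSidedTest (ε : ℝ) (𝓟 : Set (FinDist (BitString n))) : Prop :=
  T.IsTest ε 𝓟 ∧ ∀ P ∈ 𝓟, T.acceptProb P = 1

/-- The algorithm never makes more than `q` queries, whatever its coin tosses are. -/
def MakesAtMostQueries (q : ℝ) : Prop :=
  ∀ c : T.Coins, ((T.queries c).card : ℝ) ≤ q

end NonAdaptiveAlgorithm

/-! ### The non-adaptive algorithm for bounded support

The distance parameter is `2 ^ (-t)`, that is, `t` is the base-two logarithm of its inverse. -/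

/-- Samples other than the first: a block `k` (out of `2 m`), a level `a ∈ {0, …, t}`, and a position
in the sequence `S_{a,k}`, which has `2 ^ (3 - a) * 2 ^ t` samples. -/
abbrev BlockSample (m t : ℕ) : Type :=
  Fin (2 * m) × (Σ a : Fin (t + 1), Fin (2 ^ (3 + t - (a : ℕ))))

/-- All samples: `none` is the first sample `u`. -/
abbrev SampleIndex (m t : ℕ) : Type := Option (BlockSample m t)

/-- The level `a` for which a sample is queried at `I_a`; the first sample has level `t`. -/
def level {m t : ℕ} : SampleIndex m t → Fin (t + 1)
  | none => Fin.last t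
  | some x => x.2.1

/-- `⌈2 ^ (a + 2) * log₂ (m + 1)⌉`. -/
def indexCount (m a : ℕ) : ℕ := ⌈(2 : ℝ) ^ (a + 2) * Real.logb 2 (m + 1)⌉₊

/-- The coin tosses: a sequence of coordinates `i_1, i_2, …`, of length `indexCount m t`. -/
abbrev IndexSequence (n m t : ℕ) : Type := Fin (indexCount m t) → Fin n

/-- `I_a`, the set of the first `indexCount m a` chosen coordinates. -/
def indexSet {n m t : ℕ} (c : IndexSequence n m t) (a : Fin (t + 1)) : Finset (Fin n) :=
  (Finset.univ.filter fun r : Fin (indexCount m t) => (r : ℕ) < indexCount m a).image c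

/-- Every sample of level `a` is queried at all of `I_a`. -/
def querySet {n m t : ℕ} (c : IndexSequence n m t) : Finset (SampleIndex m t × Fin n) :=
  Finset.univ.filter fun p => p.2 ∈ indexSet c (level p.1)

/-- The composition with first sample `u` that continues with the block samples `v`. The numbers
`a_i` of the composition are the levels of its samples. -/
def composition {m t ℓ : ℕ} (v : Fin ℓ → BlockSample m t) : Fin (ℓ + 1) → SampleIndex m t :=
  Fin.cons none fun i => some (v i)

/-- Every two samples of the sequence `w` have a common query with different answers. -/
def Distinguishable {n m t ℓ : ℕ} (c : IndexSequence n m t) (ans : querySet c → Bool)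
    (w : Fin ℓ → SampleIndex m t) : Prop :=
  ∀ i₁ i₂ : Fin ℓ, i₁ < i₂ →
    ∃ (j : Fin n) (h₁ : (w i₁, j) ∈ querySet c) (h₂ : (w i₂, j) ∈ querySet c),
      ans ⟨(w i₁, j), h₁⟩ ≠ ans ⟨(w i₂, j), h₂⟩

/-- The algorithm: choose the coordinates uniformly and independently (the barycenter
of the simplex is the uniform distribution over all sequences of coordinates), query all samples at their
levels, and reject if and only if there is a distinguishable composition of `m + 1` samples. -/
def compositionAlgorithm (n m t : ℕ) [NeZero n] : NonAdaptiveAlgorithm n where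
  Coins := IndexSequence n m t
  law := stdSimplex.barycenter
  Sample := SampleIndex m t
  queries := querySet
  accepted c := {ans | ¬ ∃ v : Fin m → BlockSample m t, Distinguishable c ans (composition v)}

/-- The algorithm for an arbitrary distance parameter `ε`, which is rounded down to the power of two
`2 ^ (-⌈log₂ ε⁻¹⌉)`; this changes nothing if `ε` is a power of two. -/
def boundedSupportAlgorithm (n m : ℕ) (ε : ℝ) [NeZero n] : NonAdaptiveAlgorithm n :=
  compositionAlgorithm n m ⌈Real.logb 2 ε⁻¹⌉₊

end HugeObject

end

noncomputable section

namespace HugeObject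

open Finset

/-! ### Expectations over independent samples -/

section ProductExpectation

variable {ι Ω : Type} [Fintype ι] [Fintype Ω]

/-! One-sidedness: samples that are pairwise told apart by common queries are distinct strings, so a
distribution on at most `m` strings never yields a distinguishable composition of length `m + 1`.

Soundness: list the samples by decreasing level, the first sample `u` in front, and greedily keep a
sample of level `a` if it is at distance at least `radius a` from everything kept so far. This
selection looks at whole strings and not at the coins. If `P` is far from `boundedSupport n m`, any
kept set of size at most `m` leaves a large expected distance, which `sum_farProb_ge` spreads over
the dyadic scales. Weighting each kept string by `1/2` and compensating by the exponential of half
the far probabilities gives a potential whose expectation is at most one (`prodExp_greedy_le`). If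
at most `m` strings are kept, the potential is at least 9, so this has probability at most `1/9`
(`prodExp_selected_le`).

Otherwise `m + 1` kept strings form a composition. Since levels decrease, two of its members share
all queries of the later one, and the distance of the pair is calibrated to that number of queries.
A union bound over the pairs gives failure probability at most `1/9`
(`card_not_distinguishable_le`). Altogether acceptance has probability at most `2/9`. -/

/-- Expectation of `f` over a family of independent samples from `P`. -/
def prodExp [DecidableEq ι] (P : FinDist Ω) (f : (ι → Ω) → ℝ) : ℝ :=
  ∑ M : ι → Ω, (∏ i, P (M i)) * f M

theorem prod_weight_nonneg (P : FinDist Ω) (M : ι → Ω) : 0 ≤ ∏ i, P (M i) :=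
  prod_nonneg fun i _ => stdSimplex.zero_le P (M i)

theorem sum_prod_weight [DecidableEq ι] (P : FinDist Ω) : ∑ M : ι → Ω, ∏ i, P (M i) = 1 := by
  have h := Finset.prod_univ_sum (fun _ : ι => (univ : Finset Ω)) (fun _ x => P x)
  rw [Fintype.piFinset_univ] at h
  rw [← h]
  exact prod_eq_one fun i _ => stdSimplex.sum_eq_one P

theorem prodExp_mono [DecidableEq ι] (P : FinDist Ω) {f g : (ι → Ω) → ℝ} (h : ∀ M, f M ≤ g M) :
    prodExp P f ≤ prodExp P g :=
  sum_le_sum fun M _ => mul_le_mul_of_nonneg_left (h M) (prod_weight_nonneg P M)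

theorem prodExp_const_mul [DecidableEq ι] (P : FinDist Ω) (a : ℝ) (f : (ι → Ω) → ℝ) :
    prodExp P (fun M => a * f M) = a * prodExp P f := by
  simp only [prodExp, mul_sum]
  exact sum_congr rfl fun M _ => by ring

theorem prodExp_const [DecidableEq ι] (P : FinDist Ω) (a : ℝ) : prodExp (ι := ι) P (fun _ => a) = a := by
  simp only [prodExp, ← sum_mul, sum_prod_weight, one_mul]

theorem prodExp_eq_split [DecidableEq ι] (P : FinDist Ω) (f : (ι → Ω) → ℝ) (i : ι) :
    prodExp P f = ∑ x, P x * ∑ M : {j // j ≠ i} → Ω,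
      (∏ j, P (M j)) * f ((Equiv.funSplitAt i Ω).symm (x, M)) := by
  unfold prodExp
  rw [← (Equiv.funSplitAt i Ω).symm.sum_comp, Fintype.sum_prod_type]
  refine sum_congr rfl fun x _ => ?_
  rw [mul_sum]
  refine sum_congr rfl fun M _ => ?_
  rw [← mul_assoc]
  congr 1
  rw [← Finset.mul_prod_erase univ _ (mem_univ i)]
  congr 1
  · simp [Equiv.funSplitAt, Equiv.piSplitAt]
  · rw [Finset.prod_subtype (p := fun j => j ≠ i) (univ.erase i) (by simp)]
    refine prod_congr rfl fun j _ => ?_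
    simp [Equiv.funSplitAt, Equiv.piSplitAt, j.2]

/-- One of the independent samples may be drawn anew. -/
theorem prodExp_update [DecidableEq ι] (P : FinDist Ω) (f : (ι → Ω) → ℝ) (i : ι) :
    prodExp P f = ∑ x, P x * prodExp P fun M => f (Function.update M i x) := by
  have key : ∀ (x y : Ω) (M : {j // j ≠ i} → Ω),
      Function.update ((Equiv.funSplitAt i Ω).symm (y, M)) i x
        = (Equiv.funSplitAt i Ω).symm (x, M) := by
    intro x y M
    funext j
    by_cases h : j = i
    · subst h; simp [Equiv.funSplitAt, Equiv.piSplitAt]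
    · simp [Equiv.funSplitAt, Equiv.piSplitAt, h]
  rw [prodExp_eq_split P f i]
  refine sum_congr rfl fun x _ => ?_
  rw [prodExp_eq_split P _ i]
  simp only [key]
  -- The update overwrites the old value `y`, so only the total mass of `y` remains.
  rw [← sum_mul]
  rw [stdSimplex.sum_eq_one P, one_mul]

end ProductExpectation

/-! ### Greedy selection of separated samples -/

section Greedy

variable {ι Ω : Type} [DecidableEq Ω] (d : Ω → Ω → ℝ) (r : ι → ℝ)

open Classical in
/-- Insertion of `x` into `A`, provided that its distance from `A` is at least `ρ`. -/
def insertFar (ρ : ℝ) (x : Ω) (A : Finset Ω) : Finset Ω :=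
  if ∀ y ∈ A, ρ ≤ d x y then insert x A else A

theorem subset_insertFar (ρ : ℝ) (x : Ω) (A : Finset Ω) : A ⊆ insertFar d ρ x A := by
  rw [insertFar]
  split_ifs
  exacts [subset_insert _ _, Subset.refl _]

/-- The set obtained from `A` by running through the samples `M i`, where `i` runs through a list, and
inserting every sample whose distance from the current set is at least `r i`. -/
def greedy (M : ι → Ω) : List ι → Finset Ω → Finset Ω
  | [], A => A
  | i :: l, A => greedy M l (insertFar d (r i) (M i) A)

theorem subset_greedy (M : ι → Ω) (l : List ι) (A : Finset Ω) : A ⊆ greedy d r M l A := by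
  induction l generalizing A with
  | nil => exact Subset.refl A
  | cons i l ih =>
    exact (subset_insertFar d _ _ A).trans (ih _)

theorem greedy_congr {M M' : ι → Ω} {l : List ι} (h : ∀ i ∈ l, M i = M' i) (A : Finset Ω) :
    greedy d r M l A = greedy d r M' l A := by
  induction l generalizing A with
  | nil => rfl
  | cons i l ih =>
    rw [greedy, greedy, h i (by simp)]
    exact ih (fun j hj => h j (by simp [hj])) _

variable {d r}

/-- The greedily selected samples form a sublist in which every member is separated from `A` and from
all preceding members. -/
theorem exists_sublist_greedy (hd : ∀ x, d x x = 0) (hr : ∀ i, 0 < r i) (M : ι → Ω) (l : List ι)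
    (A : Finset Ω) : ∃ s : List ι, s.Sublist l ∧ (∀ i ∈ s, ∀ y ∈ A, r i ≤ d (M i) y) ∧
      s.Pairwise (fun i j => r j ≤ d (M j) (M i)) ∧
      #(greedy d r M l A) = #A + s.length := by
  induction l generalizing A with
  | nil => exact ⟨[], by simp [greedy]⟩
  | cons i l ih =>
    rw [greedy, insertFar]
    split_ifs with h
    · obtain ⟨s, hs, hsA, hp, hc⟩ := ih (insert (M i) A)
      have hi : M i ∉ A := fun hm => by
        have := h _ hm
        rw [hd] at this
        exact absurd this (not_le.2 (hr i))
      refine ⟨i :: s, hs.cons_cons i, ?_, ?_, ?_⟩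
      · intro j hj y hy
        rcases List.mem_cons.1 hj with rfl | hj
        · exact h y hy
        · exact hsA j hj y (mem_insert_of_mem hy)
      · exact List.pairwise_cons.2 ⟨fun j hj => hsA j hj _ (mem_insert_self _ _), hp⟩
      · rw [hc, card_insert_of_notMem hi, List.length_cons]; omega
    · obtain ⟨s, hs, hsA, hp, hc⟩ := ih A
      exact ⟨s, hs.cons i, hsA, hp, hc⟩

variable [Fintype Ω]

variable (d) in
open Classical in
/-- Probability that a sample has distance at least `ρ` from all members of `A`. -/
def farProb (P : FinDist Ω) (ρ : ℝ) (A : Finset Ω) : ℝ :=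
  ∑ x, if ∀ y ∈ A, ρ ≤ d x y then P x else 0

theorem farProb_nonneg (P : FinDist Ω) (ρ : ℝ) (A : Finset Ω) : 0 ≤ farProb d P ρ A :=
  sum_nonneg fun x _ => by split_ifs; exacts [stdSimplex.zero_le P x, le_rfl]

/-- This lets the far probability of the final set stand in, as a lower bound, for the one at the
moment a sample is drawn. -/
theorem farProb_anti (P : FinDist Ω) (ρ : ℝ) {A B : Finset Ω} (h : A ⊆ B) :
    farProb d P ρ B ≤ farProb d P ρ A := by
  classical
  refine sum_le_sum fun x _ => ?_
  by_cases hB : ∀ y ∈ B, ρ ≤ d x y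
  · rw [if_pos hB, if_pos fun y hy => hB y (h hy)]
  · rw [if_neg hB]
    split_ifs; exacts [stdSimplex.zero_le P x, le_rfl]

/-- The greedy selection can only stay small if, at the end, samples far from the selected set are
unlikely. -/
theorem prodExp_greedy_le [Fintype ι] [DecidableEq ι] (hd : ∀ x, d x x = 0) (hr : ∀ i, 0 < r i)
    (P : FinDist Ω) {l : List ι} (hl : l.Nodup) (A : Finset Ω) :
    prodExp P (fun M => (1 / 2) ^ #(greedy d r M l A) *
      Real.exp ((l.map fun i => farProb d P (r i) (greedy d r M l A)).sum / 2)) ≤ (1 / 2) ^ #A := by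
  classical
  induction l generalizing A with
  | nil => simp [greedy, prodExp_const]
  | cons i l ih =>
    obtain ⟨hi, hl⟩ := List.nodup_cons.1 hl
    set p := farProb d P (r i) A with hp
    -- Fix the first listed sample to be `x` and apply the induction hypothesis to the set after its
    -- insertion.
    have step : ∀ x, prodExp P (fun M =>
        (1 / 2) ^ #(greedy d r (Function.update M i x) (i :: l) A) *
        Real.exp (((i :: l).map fun j => farProb d P (r j)
          (greedy d r (Function.update M i x) (i :: l) A)).sum / 2))
        ≤ Real.exp (p / 2) * ((1 / 2) ^ #A * (if ∀ y ∈ A, r i ≤ d x y then 1 / 2 else 1)) := by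
      intro x
      set B := insertFar d (r i) x A with hB
      -- The list has no repetitions, so the redrawn sample is not met again.
      have hg : ∀ M : ι → Ω, greedy d r (Function.update M i x) (i :: l) A = greedy d r M l B := by
        intro M
        rw [greedy, Function.update_self]
        refine greedy_congr d r (fun j hj => ?_) _
        rw [Function.update_of_ne]
        rintro rfl
        exact hi hj
      have hAB : A ⊆ B := subset_insertFar d _ _ A
      have hcard : ((1 : ℝ) / 2) ^ #B = (1 / 2) ^ #A * (if ∀ y ∈ A, r i ≤ d x y then 1 / 2 else 1) := by
        rw [hB, insertFar]
        split_ifs with h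
        · have hx : x ∉ A := fun hm => by
            have := h _ hm
            rw [hd] at this
            exact absurd this (not_le.2 (hr i))
          rw [card_insert_of_notMem hx, pow_succ]
        · rw [mul_one]
      simp only [hg]
      rw [← hcard]
      refine le_trans ?_ (mul_le_mul_of_nonneg_left (ih hl B) (Real.exp_pos _).le)
      rw [← prodExp_const_mul]
      refine prodExp_mono P fun M => ?_
      rw [List.map_cons, List.sum_cons, add_div, Real.exp_add]
      have hle : Real.exp (farProb d P (r i) (greedy d r M l B) / 2) ≤ Real.exp (p / 2) := by
        have := farProb_anti (d := d) P (r i) (hAB.trans (subset_greedy d r M l B))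
        exact Real.exp_le_exp.2 (by linarith)
      rw [mul_left_comm]
      gcongr
    rw [prodExp_update P _ i]
    refine (sum_le_sum fun x _ => mul_le_mul_of_nonneg_left (step x) (stdSimplex.zero_le P x)).trans ?_
    have hsum : ∑ x, P x * (if ∀ y ∈ A, r i ≤ d x y then (1 : ℝ) / 2 else 1) = 1 - p / 2 := by
      have h1 : ∑ x, (P x - (if ∀ y ∈ A, r i ≤ d x y then P x else 0) / 2) = 1 - p / 2 := by
        rw [sum_sub_distrib, ← sum_div, stdSimplex.sum_eq_one P, hp, farProb]
      rw [← h1]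
      refine sum_congr rfl fun x _ => ?_
      split_ifs <;> ring
    calc _ = (1 / 2) ^ #A * (Real.exp (p / 2) *
            ∑ x, P x * (if ∀ y ∈ A, r i ≤ d x y then (1 : ℝ) / 2 else 1)) := by
          rw [mul_sum, mul_sum]; exact sum_congr rfl fun x _ => by ring
      _ ≤ (1 / 2) ^ #A * 1 := by
          rw [hsum]
          refine mul_le_mul_of_nonneg_left ?_ (by positivity)
          -- The expected gain `1 - p / 2` from halving on insertion pays for the factor `exp (p /
          -- 2)`.
          calc _ ≤ Real.exp (p / 2) * Real.exp (-(p / 2)) :=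
                mul_le_mul_of_nonneg_left (Real.one_sub_le_exp_neg _) (Real.exp_pos _).le
            _ = 1 := by rw [← Real.exp_add]; simp
      _ = _ := mul_one _

end Greedy

/-! ### Distances -/

theorem stringDist_nonneg {n : ℕ} (u v : BitString n) : 0 ≤ stringDist u v := by
  unfold stringDist; positivity

theorem stringDist_self {n : ℕ} (u : BitString n) : stringDist u u = 0 := by
  simp [stringDist]

theorem stringDist_le_one {n : ℕ} (u v : BitString n) : stringDist u v ≤ 1 := by
  unfold stringDist
  refine div_le_one_of_le₀ ?_ (by positivity)
  have := hammingDist_le_card_fintype (x := u) (y := v)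
  rw [Fintype.card_fin] at this
  exact_mod_cast this

theorem transferCost_nonneg {n : ℕ} (T : FinDist (BitString n × BitString n)) :
    0 ≤ ∑ p, T.1 p * stringDist p.1 p.2 :=
  sum_nonneg fun p _ => mul_nonneg (T.2.1 p) (stringDist_nonneg _ _)

theorem earthMoverDist_nonneg {n : ℕ} (P Q : FinDist (BitString n)) : 0 ≤ earthMoverDist P Q :=
  Real.iInf_nonneg fun T => transferCost_nonneg T.1

/-- Moving every string `x` to `f x` bounds the earth mover's distance. -/
theorem earthMoverDist_map_le {n : ℕ} (P : FinDist (BitString n)) (f : BitString n → BitString n) :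
    earthMoverDist P (stdSimplex.map f P) ≤ ∑ x, P x * stringDist x (f x) := by
  classical
  let T : FinDist (BitString n × BitString n) :=
    ⟨fun p => if p.2 = f p.1 then P p.1 else 0,
      fun p => by dsimp only; split_ifs; exacts [stdSimplex.zero_le P _, le_rfl],
      by rw [Fintype.sum_prod_type]; simp⟩
  have hTv : ∀ a b, T (a, b) = if b = f a then P a else 0 := fun a b => rfl
  have hT : T ∈ transferDistributions P (stdSimplex.map f P) := by
    refine ⟨fun a => by simp [hTv], fun b => ?_⟩
    rw [stdSimplex.map_coe, FunOnFinite.linearMap_apply_apply]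
    simp only [hTv, eq_comm (a := b)]
    rw [← sum_filter]
  refine (ciInf_le ⟨0, ?_⟩ (⟨T, hT⟩ : transferDistributions P (stdSimplex.map f P))).trans_eq ?_
  · rintro _ ⟨S, rfl⟩
    exact transferCost_nonneg S.1
  · rw [Fintype.sum_prod_type]
    refine sum_congr rfl fun x _ => ?_
    rw [sum_eq_single (f x)]
    · exact congrArg (· * _) (if_pos rfl)
    · intro y _ hy
      exact (congrArg (· * _) (if_neg hy)).trans (zero_mul _)
    · simp

/-- The pushforward of `P` under `f` lives on `A`, hence competes in the infimum. -/
theorem distToProperty_boundedSupport_le {n m : ℕ} (P : FinDist (BitString n))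
    (A : Finset (BitString n)) (hA : #A ≤ m) (f : BitString n → BitString n) (hf : ∀ x, f x ∈ A) :
    distToProperty P (boundedSupport n m) ≤ ∑ x, P x * stringDist x (f x) := by
  classical
  have hQ : stdSimplex.map f P ∈ boundedSupport n m := by
    have hsub : {y | stdSimplex.map f P y ≠ 0} ⊆ (A : Set (BitString n)) := by
      intro y hy
      by_contra hyA
      apply hy
      rw [stdSimplex.map_coe, FunOnFinite.linearMap_apply_apply]
      refine sum_eq_zero fun x hx => ?_
      exact absurd (hf x) (by rw [(mem_filter.1 hx).2]; exact hyA)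
    refine (Set.ncard_le_ncard hsub A.finite_toSet).trans ?_
    rwa [Set.ncard_coe_finset]
  refine (ciInf_le ⟨0, ?_⟩ (⟨_, hQ⟩ : boundedSupport n m)).trans (earthMoverDist_map_le P f)
  rintro _ ⟨S, rfl⟩
  exact earthMoverDist_nonneg _ _

/-! ### Dyadic distance scales -/

/-- The distance that a sample of level `a` must have from previously selected samples. -/
def radius (a : ℕ) : ℝ := 3 / 4 * (1 / 2) ^ a

theorem radius_pos (a : ℕ) : 0 < radius a := by unfold radius; positivity

open Classical in
/-- A number of at most one is approximated by the sum of the powers of two that it dominates. -/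
theorem sum_pow_ge (t : ℕ) {d : ℝ} (hd : d ≤ 1) :
    4 / 3 * d - (1 / 2) ^ t ≤
      ∑ a ∈ range (t + 1), if radius a ≤ d then ((1 : ℝ) / 2) ^ a else 0 := by
  induction t with
  | zero =>
    rw [sum_range_one]
    unfold radius
    split_ifs with h
    · norm_num; linarith
    · norm_num at h ⊢; linarith
  | succ t ih =>
    rw [sum_range_succ]
    -- A counted new term improves the error from `(1/2)^t` to `(1/2)^(t+1)`; an uncounted one means
    -- `4/3 * d < (1/2)^(t+1)`, so the left side is negative.
    split_ifs with h
    · refine le_trans ?_ (add_le_add_left ih _)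
      rw [pow_succ]; linarith
    · have h0 : 0 ≤ ∑ a ∈ range (t + 1), if radius a ≤ d then ((1 : ℝ) / 2) ^ a else 0 :=
        sum_nonneg fun a _ => by split_ifs <;> positivity
      unfold radius at h
      linarith

/-- If `P` is far from having bounded support, then samples are likely to be far from any small set, in
the average over all distance scales. -/
theorem sum_farProb_ge {n m t : ℕ} (P : FinDist (BitString n))
    (h : (1 / 2) ^ t < distToProperty P (boundedSupport n m)) {A : Finset (BitString n)}
    (hne : A.Nonempty) (hA : #A ≤ m) :
    (1 / 2) ^ t / 3 ≤ ∑ a ∈ range (t + 1), (1 / 2) ^ a * farProb stringDist P (radius a) A := by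
  classical
  -- Moving each string to a nearest point of `A` costs more than `(1/2)^t` on average; the factor
  -- `4/3` minus the error `(1/2)^t` leaves the claimed third.
  choose f hfA hf using fun x => exists_min_image A (stringDist x) hne
  have h1 := h.le.trans (distToProperty_boundedSupport_le P A hA f hfA)
  have h2 : ∑ a ∈ range (t + 1), (1 / 2) ^ a * farProb stringDist P (radius a) A
      = ∑ x, P x * ∑ a ∈ range (t + 1),
          if radius a ≤ stringDist x (f x) then ((1 : ℝ) / 2) ^ a else 0 := by
    simp only [farProb, mul_sum]
    rw [sum_comm]
    refine sum_congr rfl fun x _ => sum_congr rfl fun a _ => ?_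
    have : (∀ y ∈ A, radius a ≤ stringDist x y) ↔ radius a ≤ stringDist x (f x) :=
      ⟨fun h => h _ (hfA x), fun h y hy => h.trans (hf x y hy)⟩
    simp only [this]
    split_ifs <;> ring
  rw [h2]
  calc (1 / 2 : ℝ) ^ t / 3 ≤ 4 / 3 * ∑ x, P x * stringDist x (f x) - (1 / 2) ^ t := by linarith
    _ = ∑ x, P x * (4 / 3 * stringDist x (f x) - (1 / 2) ^ t) := by
        simp only [mul_sub, sum_sub_distrib, ← sum_mul, stdSimplex.sum_eq_one P, mul_sum, one_mul]
        congr 1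
        exact sum_congr rfl fun x _ => by ring
    _ ≤ _ := sum_le_sum fun x _ =>
        mul_le_mul_of_nonneg_left (sum_pow_ge t (stringDist_le_one _ _)) (stdSimplex.zero_le P x)

/-! ### Uniform sequences of coordinates -/

/-- The number of coordinate sequences that fail to tell two strings apart within their first `k`
terms. -/
theorem card_agree_le {n K k : ℕ} [NeZero n] (hk : k ≤ K) (x y : BitString n) :
    (#{c : Fin K → Fin n | ∀ r : Fin K, (r : ℕ) < k → x (c r) = y (c r)} : ℝ) / (n : ℝ) ^ K
      ≤ Real.exp (-(stringDist x y * k)) := by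
  classical
  have hn : (0 : ℝ) < n := by exact_mod_cast Nat.pos_of_neZero n
  set G : Finset (Fin n) := univ.filter fun j => x j = y j with hG
  -- The bad sequences form a box: the first `k` terms avoid the differing coordinates, the others
  -- are free.
  have h1 : ({c : Fin K → Fin n | ∀ r : Fin K, (r : ℕ) < k → x (c r) = y (c r)} : Finset _)
      = Fintype.piFinset fun r : Fin K => if (r : ℕ) < k then G else univ := by
    ext c
    simp only [mem_filter, mem_univ, true_and, Fintype.mem_piFinset]
    refine forall_congr' fun r => ?_
    split_ifs with h <;> simp [h, hG]
  have hcG : (#G : ℝ) / n = 1 - stringDist x y := by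
    have h := card_filter_add_card_filter_not (s := (univ : Finset (Fin n))) (fun j => x j = y j)
    rw [card_univ, Fintype.card_fin] at h
    have h' : (#G : ℝ) + hammingDist x y = n := by exact_mod_cast h
    unfold stringDist
    field_simp
    linarith
  have h2 : (#{c : Fin K → Fin n | ∀ r : Fin K, (r : ℕ) < k → x (c r) = y (c r)} : ℝ) / (n : ℝ) ^ K
      = ∏ r : Fin K, if (r : ℕ) < k then (#G : ℝ) / n else 1 := by
    rw [h1, Fintype.card_piFinset, Nat.cast_prod]
    have : (n : ℝ) ^ K = ∏ _r : Fin K, (n : ℝ) := by simp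
    rw [this, ← prod_div_distrib]
    refine prod_congr rfl fun r _ => ?_
    split_ifs with h
    · rfl
    · rw [card_univ, Fintype.card_fin, div_self hn.ne']
  have hcard : #{r : Fin K | (r : ℕ) < k} = k := by
    rw [Fin.card_filter_val_lt, min_eq_right hk]
  rw [h2, ← prod_filter, prod_const, hcard, hcG, ← neg_mul, mul_comm, Real.exp_nat_mul]
  refine pow_le_pow_left₀ ?_ (Real.one_sub_le_exp_neg _) k
  linarith [stringDist_le_one x y]

theorem indexCount_mono (m : ℕ) {a b : ℕ} (h : a ≤ b) : indexCount m a ≤ indexCount m b := by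
  refine Nat.ceil_mono (mul_le_mul_of_nonneg_right (pow_le_pow_right₀ one_le_two (by omega)) ?_)
  exact Real.logb_nonneg one_lt_two (by linarith [m.cast_nonneg (α := ℝ)])

theorem indexSet_mono {n m t : ℕ} (c : IndexSequence n m t) {a b : Fin (t + 1)} (h : a ≤ b) :
    indexSet c a ⊆ indexSet c b := by
  refine image_subset_image fun r hr => ?_
  simp only [mem_filter, mem_univ, true_and] at hr ⊢
  exact hr.trans_le (indexCount_mono m h)

/-- The scales cancel: `3/4 * 2^(-a)` times `2^(a+2)` is 3, and `3 > 4 * log 2` in natural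
logarithms. The exponent 4 leaves room for a union bound over pairs. -/
theorem exp_radius_indexCount_le (m a : ℕ) {δ : ℝ} (hδ : radius a ≤ δ) :
    Real.exp (-(δ * indexCount m a)) ≤ ((m : ℝ) + 1) ^ (-4 : ℤ) := by
  have hm : (0 : ℝ) < (m : ℝ) + 1 := by positivity
  have hL : 0 ≤ Real.logb 2 ((m : ℝ) + 1) :=
    Real.logb_nonneg one_lt_two (by linarith [m.cast_nonneg (α := ℝ)])
  have h1 : (2 : ℝ) ^ (a + 2) * Real.logb 2 (m + 1) ≤ indexCount m a := Nat.le_ceil _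
  have h2 : 3 * Real.logb 2 ((m : ℝ) + 1) ≤ δ * indexCount m a := by
    calc 3 * Real.logb 2 ((m : ℝ) + 1)
        = radius a * ((2 : ℝ) ^ (a + 2) * Real.logb 2 (m + 1)) := by
          have : (1 / 2 : ℝ) ^ a * 2 ^ a = 1 := by rw [← mul_pow]; norm_num
          unfold radius
          rw [pow_add]
          linear_combination (-3 * Real.logb 2 ((m : ℝ) + 1)) * this
      _ ≤ radius a * indexCount m a := mul_le_mul_of_nonneg_left h1 (radius_pos a).le
      _ ≤ _ := mul_le_mul_of_nonneg_right hδ (Nat.cast_nonneg _)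
  have h3 : Real.log ((m : ℝ) + 1) = Real.logb 2 ((m : ℝ) + 1) * Real.log 2 := by
    rw [Real.logb, div_mul_cancel₀ _ (Real.log_pos one_lt_two).ne']
  rw [← Real.exp_log (zpow_pos hm (-4)), Real.log_zpow, h3]
  refine Real.exp_le_exp.2 ?_
  have := Real.log_two_lt_d9
  push_cast
  nlinarith

/-! ### Acceptance probabilities -/

theorem NonAdaptiveAlgorithm.acceptProb_add_rejectProb {n : ℕ} (T : NonAdaptiveAlgorithm n)
    (P : FinDist (BitString n)) : T.acceptProb P + T.rejectProb P = 1 := by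
  classical
  unfold acceptProb rejectProb runProb
  rw [← sum_add_distrib, ← stdSimplex.sum_eq_one T.law]
  refine sum_congr rfl fun c _ => ?_
  have h : ∑ M : T.Sample → BitString n, T.law c * ∏ i, P (M i) = T.law c := by
    rw [← mul_sum, sum_prod_weight, mul_one]
  rw [← sum_add_distrib]
  refine Eq.trans (sum_congr rfl fun M _ => ?_) h
  by_cases h : T.answers c M ∈ T.accepted c <;> simp [h]

variable {n m t : ℕ}

/-- The answers to the queries when the samples are given by `M`. -/
def answerVector (c : IndexSequence n m t) (M : SampleIndex m t → BitString n) :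
    querySet c → Bool := fun q => M q.1.1 q.1.2

theorem Distinguishable.injective {ℓ : ℕ} {c : IndexSequence n m t}
    {M : SampleIndex m t → BitString n} {w : Fin ℓ → SampleIndex m t}
    (h : Distinguishable c (answerVector c M) w) : Function.Injective fun i => M (w i) := by
  have key : ∀ i j, i < j → M (w i) ≠ M (w j) := fun i j hij he => by
    obtain ⟨k, h₁, h₂, hne⟩ := h i j hij
    exact hne (congrFun he k)
  intro i j hij
  rcases lt_trichotomy i j with hlt | heq | hlt
  · exact absurd hij (key i j hlt)
  · exact heq
  · exact absurd hij.symm (key j i hlt)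

/-- A rejecting run of positive probability would exhibit `m + 1` distinct strings in the support.
-/
theorem rejectProb_eq_zero [NeZero n] {P : FinDist (BitString n)} (hP : P ∈ boundedSupport n m) :
    (compositionAlgorithm n m t).rejectProb P = 0 := by
  classical
  refine sum_eq_zero fun c _ => sum_eq_zero fun M _ => ?_
  split_ifs with hrej
  · refine mul_eq_zero_of_right _ ?_
    by_contra hprod
    have hpos := fun i => prod_ne_zero_iff.1 hprod i (mem_univ i)
    obtain ⟨v, hv⟩ := not_not.1 hrej
    have hinj := Distinguishable.injective (M := M) hv
    have hsub : Set.range (fun i => M (composition v i)) ⊆ {x | P x ≠ 0} := by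
      rintro _ ⟨i, rfl⟩
      exact hpos _
    have h1 := Set.ncard_le_ncard hsub (Set.toFinite _)
    rw [Set.ncard_range_of_injective hinj, Nat.card_eq_fintype_card, Fintype.card_fin] at h1
    have h2 : {x | P x ≠ 0}.ncard ≤ m := hP
    omega
  · rfl

-- Summing over the coins inside makes it possible to choose a composition from the samples alone
-- and only then count the coordinate sequences that miss it.
open Classical in
theorem acceptProb_eq [NeZero n] (P : FinDist (BitString n)) :
    (compositionAlgorithm n m t).acceptProb P = prodExp P fun M : SampleIndex m t → BitString n =>
      (#{c : IndexSequence n m t | ¬ ∃ v : Fin m → BlockSample m t,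
        Distinguishable c (answerVector c M) (composition v)} : ℝ) / (n : ℝ) ^ indexCount m t := by
  have hlaw : ∀ c : IndexSequence n m t,
      (stdSimplex.barycenter : FinDist (IndexSequence n m t)) c = ((n : ℝ) ^ indexCount m t)⁻¹ := by
    intro c
    have : (Fintype.card (IndexSequence n m t) : ℝ) = (n : ℝ) ^ indexCount m t := by simp
    rw [← this]
    rfl
  unfold NonAdaptiveAlgorithm.acceptProb NonAdaptiveAlgorithm.runProb
  rw [sum_comm]
  refine sum_congr rfl fun M _ => ?_
  trans ∑ c : IndexSequence n m t, if ¬ ∃ v : Fin m → BlockSample m t,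
      Distinguishable c (answerVector c M) (composition v) then
    ((n : ℝ) ^ indexCount m t)⁻¹ * ∏ i, P (M i) else 0
  · refine sum_congr rfl fun c _ => ?_
    rw [← hlaw c]
    exact if_congr Iff.rfl rfl rfl
  · rw [← sum_filter, sum_const, nsmul_eq_mul]
    have h : ∀ a b x : ℝ, a * (b⁻¹ * x) = x * (a / b) := fun a b x => by ring
    exact h _ _ _

/-! ### Separated compositions -/

/-- A composition whose levels decrease, and whose members are far from all earlier ones in terms of
their levels. -/
def Separated (M : SampleIndex m t → BitString n) (v : Fin m → BlockSample m t) : Prop :=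
  ∀ i₁ i₂ : Fin (m + 1), i₁ < i₂ →
    level (composition v i₂) ≤ level (composition v i₁) ∧
      radius (level (composition v i₂)) ≤ stringDist (M (composition v i₂)) (M (composition v i₁))

open Classical in
/-- A random sequence of coordinates distinguishes any separated composition with high probability. -/
theorem card_not_distinguishable_le [NeZero n] (hm : 2 ≤ m) {M : SampleIndex m t → BitString n}
    {v : Fin m → BlockSample m t} (hv : Separated M v) :
    (#{c : IndexSequence n m t | ¬ Distinguishable c (answerVector c M) (composition v)} : ℝ)
      / (n : ℝ) ^ indexCount m t ≤ 1 / 9 := by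
  set w := composition v with hw
  let B : Fin (m + 1) × Fin (m + 1) → Finset (IndexSequence n m t) := fun p =>
    {c | ∀ r : Fin (indexCount m t), (r : ℕ) < indexCount m (level (w p.2)) →
      M (w p.2) (c r) = M (w p.1) (c r)}
  let S : Finset (Fin (m + 1) × Fin (m + 1)) := {p | p.1 < p.2}
  have hsub : ({c : IndexSequence n m t | ¬ Distinguishable c (answerVector c M) w} : Finset _)
      ⊆ S.biUnion B := by
    intro c hc
    have hc := (mem_filter.1 hc).2
    unfold Distinguishable at hc
    push Not at hc
    obtain ⟨i₁, i₂, hlt, h⟩ := hc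
    refine mem_biUnion.2 ⟨(i₁, i₂), by simpa [S] using hlt, ?_⟩
    simp only [B, mem_filter, mem_univ, true_and]
    intro r hr
    have h₂ : c r ∈ indexSet c (level (w i₂)) :=
      mem_image_of_mem c (by simpa using hr)
    -- Decreasing levels make every query of the later sample a common query.
    have h₁ : c r ∈ indexSet c (level (w i₁)) := indexSet_mono c (hv i₁ i₂ hlt).1 h₂
    exact (h (c r) (by simpa [querySet] using h₁) (by simpa [querySet] using h₂)).symm
  have hB : ∀ p ∈ S, (#(B p) : ℝ) / (n : ℝ) ^ indexCount m t ≤ ((m : ℝ) + 1) ^ (-4 : ℤ) := by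
    intro p hp
    have hp' : p.1 < p.2 := by simpa [S] using hp
    refine (card_agree_le (indexCount_mono m (Nat.lt_succ_iff.1 (level (w p.2)).2)) _ _).trans ?_
    exact exp_radius_indexCount_le m _ (hv p.1 p.2 hp').2
  have hm' : (3 : ℝ) ≤ (m : ℝ) + 1 := by
    have : (2 : ℝ) ≤ m := by exact_mod_cast hm
    linarith
  have hS : (#S : ℝ) ≤ ((m : ℝ) + 1) ^ 2 := by
    have : #S ≤ (m + 1) ^ 2 := (card_le_univ S).trans_eq (by simp [sq])
    exact_mod_cast this
  calc _ ≤ (∑ p ∈ S, (#(B p) : ℝ)) / (n : ℝ) ^ indexCount m t := by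
        gcongr
        exact_mod_cast (card_le_card hsub).trans card_biUnion_le
    _ = ∑ p ∈ S, (#(B p) : ℝ) / (n : ℝ) ^ indexCount m t := sum_div _ _ _
    _ ≤ ∑ _p ∈ S, ((m : ℝ) + 1) ^ (-4 : ℤ) := sum_le_sum hB
    _ = #S * ((m : ℝ) + 1) ^ (-4 : ℤ) := by rw [sum_const, nsmul_eq_mul]
    _ ≤ ((m : ℝ) + 1) ^ 2 * ((m : ℝ) + 1) ^ (-4 : ℤ) := by gcongr
    _ = 1 / ((m : ℝ) + 1) ^ 2 := by
        rw [zpow_neg]; field_simp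
    _ ≤ 1 / 3 ^ 2 := by gcongr
    _ = 1 / 9 := by norm_num

/-! ### Greedy selection by decreasing level -/

/-- The block samples can be listed by decreasing level. -/
theorem exists_list_blockSample (m t : ℕ) : ∃ l : List (BlockSample m t), l.Nodup ∧ (∀ x, x ∈ l) ∧
    l.Pairwise fun x y => y.2.1 ≤ x.2.1 := by
  classical
  let R : BlockSample m t → BlockSample m t → Prop := fun x y => y.2.1 ≤ x.2.1
  have : Std.Total R := ⟨fun x y => le_total _ _⟩
  have : IsTrans _ R := ⟨fun x y z h h' => le_trans h' h⟩
  have hp := List.perm_insertionSort R (univ : Finset (BlockSample m t)).toList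
  exact ⟨_, hp.nodup_iff.2 (nodup_toList _), fun x => hp.mem_iff.2 (by simp),
    List.pairwise_insertionSort R _⟩

/-- The strings obtained by running greedily through all samples, beginning with the first one. -/
def selected (l : List (BlockSample m t)) (M : SampleIndex m t → BitString n) :
    Finset (BitString n) :=
  greedy stringDist (fun i => radius (level i)) M (none :: l.map some) ∅

/-- Insertion into the empty set always succeeds, so `u` is kept, as a composition requires. -/
theorem selected_eq (l : List (BlockSample m t)) (M : SampleIndex m t → BitString n) :
    selected l M = greedy stringDist (fun i => radius (level i)) M (l.map some) {M none} := by
  simp [selected, greedy, insertFar]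

theorem exists_separated {l : List (BlockSample m t)} (hl : l.Pairwise fun x y => y.2.1 ≤ x.2.1)
    {M : SampleIndex m t → BitString n} (h : m < #(selected l M)) :
    ∃ v : Fin m → BlockSample m t, Separated M v := by
  rw [selected_eq] at h
  obtain ⟨s, hs, hsA, hsp, hc⟩ := exists_sublist_greedy (d := stringDist)
    (r := fun i : SampleIndex m t => radius (level i)) stringDist_self (fun i => radius_pos _) M
    (l.map some) {M none}
  rw [hc, card_singleton] at h
  obtain ⟨s', hs', rfl⟩ := List.sublist_map_iff.1 hs
  rw [List.length_map] at h
  have hlen : m ≤ s'.length := by omega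
  refine ⟨fun i => s'[i], ?_⟩
  rw [List.pairwise_map] at hsp
  have hsl := hl.sublist hs'
  intro i₁ i₂ hlt
  obtain ⟨j₂, rfl⟩ := Fin.exists_succ_eq.2 (Fin.ne_zero_of_lt hlt)
  induction i₁ using Fin.cases with
  -- The first sample has the top level `t`, so it fits in front of any decreasing list.
  | zero => exact ⟨Fin.le_last _, hsA _ (List.mem_map_of_mem (List.getElem_mem _)) _ (by simp; rfl)⟩
  | succ j₁ =>
    have hlt' : (j₁ : ℕ) < j₂ := Fin.succ_lt_succ_iff.1 hlt
    exact ⟨List.pairwise_iff_getElem.1 hsl _ _ _ _ hlt', List.pairwise_iff_getElem.1 hsp _ _ _ _ hlt'⟩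

theorem sum_blockSample (f : ℕ → ℝ) :
    ∑ x : BlockSample m t, f x.2.1 = 2 * m * ∑ a ∈ range (t + 1), 2 ^ (3 + t - a) * f a := by
  rw [Fintype.sum_prod_type]
  simp only [sum_const, card_univ, Fintype.card_fin, nsmul_eq_mul, Fintype.sum_sigma]
  rw [Finset.sum_range fun a => (2 : ℝ) ^ (3 + t - a) * f a]
  push_cast
  rfl

open Classical in
/-- If the input is far from having bounded support, then the greedy selection is unlikely to be
small. -/
theorem prodExp_selected_le [NeZero n] (hm : 2 ≤ m) {P : FinDist (BitString n)}
    (hP : (1 / 2) ^ t < distToProperty P (boundedSupport n m)) {l : List (BlockSample m t)}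
    (hnd : l.Nodup) (hmem : ∀ x, x ∈ l) :
    prodExp P (fun M => if #(selected l M) ≤ m then (1 : ℝ) else 0) ≤ 1 / 9 := by
  have hnd' : (none :: l.map some : List (SampleIndex m t)).Nodup :=
    List.nodup_cons.2 ⟨by simp, hnd.map (Option.some_injective _)⟩
  have hmain := prodExp_greedy_le (d := stringDist)
    (r := fun i : SampleIndex m t => radius (level i)) stringDist_self (fun i => radius_pos _) P
    hnd' ∅
  rw [card_empty, pow_zero] at hmain
  have hm' : (2 : ℝ) ≤ m := by exact_mod_cast hm
  -- Markov's inequality in pointwise form: the potential is at least 9 whenever at most `m` strings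
  -- are kept.
  have hpt : ∀ M : SampleIndex m t → BitString n, (if #(selected l M) ≤ m then (1 : ℝ) else 0) ≤
      1 / 9 * ((1 / 2) ^ #(selected l M) * Real.exp (((none :: l.map some).map fun i =>
        farProb stringDist P (radius (level i)) (selected l M)).sum / 2)) := by
    intro M
    split_ifs with hc
    swap
    · positivity
    have hne : (selected l M).Nonempty := by
      rw [selected_eq]
      exact (singleton_nonempty _).mono (subset_greedy _ _ _ _ _)
    -- The `2 * m` blocks contribute at least `2^(3+t) * (1/2)^t / 3 = 8/3` each; the term of the
    -- first sample is dropped.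
    have hsum : 16 / 3 * (m : ℝ) ≤ ((none :: l.map some : List (SampleIndex m t)).map fun i =>
        farProb stringDist P (radius (level i)) (selected l M)).sum := by
      rw [List.map_cons, List.sum_cons, List.map_map]
      have h1 : (l.map ((fun i : SampleIndex m t =>
          farProb stringDist P (radius (level i)) (selected l M)) ∘ some)).sum
          = ∑ x : BlockSample m t, farProb stringDist P (radius x.2.1) (selected l M) := by
        rw [← List.sum_toFinset _ hnd]
        exact sum_congr (by ext x; simp [hmem]) fun x _ => rfl
      rw [h1, sum_blockSample fun a => farProb stringDist P (radius a) (selected l M)]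
      have h2 := sum_farProb_ge P hP hne hc
      have h3 : ∑ a ∈ range (t + 1), (2 : ℝ) ^ (3 + t - a) *
          farProb stringDist P (radius a) (selected l M) = 2 ^ (3 + t) *
          ∑ a ∈ range (t + 1), (1 / 2) ^ a * farProb stringDist P (radius a) (selected l M) := by
        rw [mul_sum]
        refine sum_congr rfl fun a ha => ?_
        have ha' : a ≤ 3 + t := by have := mem_range.1 ha; omega
        rw [pow_sub₀ _ two_ne_zero ha', one_div, inv_pow, mul_assoc]
      have h4 : (8 / 3 : ℝ) ≤ 2 ^ (3 + t) *
          ∑ a ∈ range (t + 1), (1 / 2) ^ a * farProb stringDist P (radius a) (selected l M) := by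
        refine le_trans (le_of_eq ?_) (mul_le_mul_of_nonneg_left h2 (by positivity))
        have : (1 / 2 : ℝ) ^ t * 2 ^ t = 1 := by rw [← mul_pow]; norm_num
        rw [pow_add]
        linear_combination (-8 / 3) * this
      have h5 := farProb_nonneg (d := stringDist) P (radius (level (none : SampleIndex m t)))
        (selected l M)
      rw [h3]
      nlinarith
    have hpow : ((1 : ℝ) / 2) ^ m ≤ (1 / 2) ^ #(selected l M) :=
      pow_le_pow_of_le_one (by norm_num) (by norm_num) hc
    have hexp : (6 : ℝ) ^ m ≤ Real.exp (((none :: l.map some : List (SampleIndex m t)).map fun i =>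
        farProb stringDist P (radius (level i)) (selected l M)).sum / 2) := by
      have h2 : (6 : ℝ) ≤ Real.exp 2 := by
        have h := Real.exp_one_gt_d9
        have : Real.exp 2 = Real.exp 1 * Real.exp 1 := by rw [← Real.exp_add]; norm_num
        nlinarith
      calc (6 : ℝ) ^ m ≤ Real.exp 2 ^ m := pow_le_pow_left₀ (by norm_num) h2 m
        _ = Real.exp (m * 2) := (Real.exp_nat_mul _ _).symm
        _ ≤ _ := Real.exp_le_exp.2 (by linarith)
    -- This is `3 ^ m` with `m ≥ 2`.
    have h4 : (9 : ℝ) ≤ (1 / 2) ^ m * 6 ^ m := by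
      rw [← mul_pow]
      calc (9 : ℝ) = (1 / 2 * 6) ^ 2 := by norm_num
        _ ≤ _ := pow_le_pow_right₀ (by norm_num) hm
    have := h4.trans (mul_le_mul hpow hexp (by positivity) (by positivity))
    linarith
  refine (prodExp_mono P hpt).trans ?_
  rw [prodExp_const_mul]
  exact (mul_le_mul_of_nonneg_left hmain (by norm_num)).trans_eq (mul_one _)

theorem acceptProb_lt_third [NeZero n] (hm : 2 ≤ m) {P : FinDist (BitString n)}
    (hP : (1 / 2) ^ t < distToProperty P (boundedSupport n m)) :
    (compositionAlgorithm n m t).acceptProb P < 1 / 3 := by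
  classical
  obtain ⟨l, hnd, hmem, hl⟩ := exists_list_blockSample m t
  have hn : (0 : ℝ) < (n : ℝ) ^ indexCount m t := by
    have := Nat.pos_of_neZero n
    positivity
  have hpt : ∀ M : SampleIndex m t → BitString n,
      (#{c : IndexSequence n m t | ¬ ∃ v : Fin m → BlockSample m t,
        Distinguishable c (answerVector c M) (composition v)} : ℝ) / (n : ℝ) ^ indexCount m t
      ≤ 1 / 9 + if #(selected l M) ≤ m then (1 : ℝ) else 0 := by
    intro M
    split_ifs with h
    · have : (#{c : IndexSequence n m t | ¬ ∃ v : Fin m → BlockSample m t,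
          Distinguishable c (answerVector c M) (composition v)} : ℝ) ≤ (n : ℝ) ^ indexCount m t := by
        have h := card_le_univ ({c : IndexSequence n m t | ¬ ∃ v : Fin m → BlockSample m t,
          Distinguishable c (answerVector c M) (composition v)} : Finset _)
        rw [Fintype.card_fun, Fintype.card_fin, Fintype.card_fin] at h
        exact_mod_cast h
      have := div_le_one_of_le₀ this hn.le
      linarith
    · obtain ⟨v, hv⟩ := exists_separated hl (not_le.1 h)
      rw [add_zero]
      refine le_trans ?_ (card_not_distinguishable_le hm hv)
      refine div_le_div_of_nonneg_right (Nat.cast_le.2 (card_le_card fun c hc => ?_)) hn.le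
      rw [mem_filter] at hc ⊢
      exact ⟨hc.1, fun hd => hc.2 ⟨v, hd⟩⟩
  have h1 : (compositionAlgorithm n m t).acceptProb P ≤ 1 / 9 + 1 / 9 := by
    rw [acceptProb_eq]
    refine (prodExp_mono P hpt).trans ?_
    have h2 := prodExp_selected_le hm hP hnd hmem
    have h3 := prodExp_const (ι := SampleIndex m t) P (1 / 9)
    unfold prodExp at h2 h3 ⊢
    simp only [mul_add, sum_add_distrib]
    linarith
  linarith

/-! ### The number of queries -/

theorem indexCount_le {m : ℕ} (hm : 2 ≤ m) (a : ℕ) :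
    (indexCount m a : ℝ) ≤ 2 ^ (a + 4) * Real.logb 2 m := by
  have hm' : (2 : ℝ) ≤ m := by exact_mod_cast hm
  have h1 : 1 ≤ Real.logb 2 m := by
    rw [Real.le_logb_iff_rpow_le one_lt_two (by linarith)]
    simpa using hm'
  have h2 : Real.logb 2 ((m : ℝ) + 1) ≤ 2 * Real.logb 2 m := by
    have h := Real.logb_pow 2 (m : ℝ) 2
    push_cast at h
    rw [← h]
    exact Real.logb_le_logb_of_le one_lt_two (by linarith) (by nlinarith)
  have h0 : 0 ≤ Real.logb 2 ((m : ℝ) + 1) := Real.logb_nonneg one_lt_two (by linarith)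
  have h3 : (indexCount m a : ℝ) < 2 ^ (a + 2) * Real.logb 2 (m + 1) + 1 :=
    Nat.ceil_lt_add_one (by positivity)
  have h4 : (1 : ℝ) ≤ 2 ^ a := one_le_pow₀ one_le_two
  rw [pow_add] at h3 ⊢
  nlinarith

theorem card_indexSet_le {n m t : ℕ} (c : IndexSequence n m t) (a : Fin (t + 1)) :
    #(indexSet c a) ≤ indexCount m a := by
  refine card_image_le.trans ?_
  rw [Fin.card_filter_val_lt]
  exact min_le_right _ _

theorem card_querySet_le {n m t : ℕ} (hm : 2 ≤ m) (c : IndexSequence n m t) :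
    (#(querySet c) : ℝ) ≤ 264 * (2 ^ t * (t + 1) * (m * Real.logb 2 m)) := by
  have hm' : (2 : ℝ) ≤ m := by exact_mod_cast hm
  have hL : 0 ≤ Real.logb 2 m := Real.logb_nonneg one_lt_two (by linarith)
  have h1 : #(querySet c) = ∑ i : SampleIndex m t, #(indexSet c (level i)) := by
    rw [querySet, card_filter, Fintype.sum_prod_type]
    refine sum_congr rfl fun i _ => ?_
    rw [← card_filter]
    simp
  have h2 : ∀ i : SampleIndex m t, (#(indexSet c (level i)) : ℝ)
      ≤ 2 ^ ((level i : ℕ) + 4) * Real.logb 2 m := fun i =>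
    (Nat.cast_le.2 (card_indexSet_le c _)).trans (indexCount_le hm _)
  have h3 : ∑ x : BlockSample m t, (2 : ℝ) ^ ((level (some x) : ℕ) + 4) * Real.logb 2 m
      = 256 * (2 ^ t * (t + 1) * (m * Real.logb 2 m)) := by
    refine (sum_blockSample fun a => (2 : ℝ) ^ (a + 4) * Real.logb 2 m).trans ?_
    -- Fewer samples at higher levels balance the larger index sets: the bound is the same for every
    -- level, whence the factor `t + 1`.
    have : ∀ a ∈ range (t + 1), (2 : ℝ) ^ (3 + t - a) * (2 ^ (a + 4) * Real.logb 2 m)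
        = 128 * 2 ^ t * Real.logb 2 m := by
      intro a ha
      have ha' := mem_range.1 ha
      rw [← mul_assoc, ← pow_add, show 3 + t - a + (a + 4) = t + 7 by omega, pow_add]
      ring
    rw [sum_congr rfl this, sum_const, card_range, nsmul_eq_mul]
    push_cast
    ring
  rw [h1]
  push_cast
  refine (sum_le_sum fun i _ => h2 i).trans ?_
  rw [Fintype.sum_option, h3]
  have h4 : (2 : ℝ) ^ ((level (none : SampleIndex m t) : ℕ) + 4) * Real.logb 2 m
      = 2 ^ t * 1 * (16 * Real.logb 2 m) := by
    rw [pow_add]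
    simp only [level, Fin.val_last]
    ring
  -- The first sample accounts for the 8 in `264 = 256 + 8`.
  have h5 : (2 : ℝ) ^ t * 1 * (16 * Real.logb 2 m) ≤
      2 ^ t * (t + 1) * (8 * (m * Real.logb 2 m)) := by
    have : (0 : ℝ) ≤ t := t.cast_nonneg
    gcongr ?_ * ?_ * ?_
    · linarith
    · nlinarith
  linarith

/-! ### Rounding of the distance parameter -/

/-- Rounding only lowers the distance parameter, so soundness for the rounded value covers `ε`. -/
theorem half_pow_ceil_logb_le {ε : ℝ} (hε : 0 < ε) : (1 / 2 : ℝ) ^ ⌈Real.logb 2 ε⁻¹⌉₊ ≤ ε := by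
  have h : ε⁻¹ ≤ (2 : ℝ) ^ ⌈Real.logb 2 ε⁻¹⌉₊ := by
    rw [← Real.rpow_natCast, ← Real.logb_le_iff_le_rpow one_lt_two (inv_pos.2 hε)]
    exact Nat.le_ceil _
  rw [one_div, inv_pow]
  exact inv_le_of_inv_le₀ hε h

theorem two_pow_ceil_logb_le {ε : ℝ} (hε : 0 < ε) (hε1 : ε ≤ 1) :
    (2 : ℝ) ^ ⌈Real.logb 2 ε⁻¹⌉₊ ≤ 2 * ε⁻¹ := by
  have h := Nat.ceil_lt_add_one (Real.logb_nonneg one_lt_two ((one_le_inv₀ hε).2 hε1))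
  rw [← Real.rpow_natCast]
  calc (2 : ℝ) ^ ((⌈Real.logb 2 ε⁻¹⌉₊ : ℕ) : ℝ) ≤ 2 ^ (Real.logb 2 ε⁻¹ + 1) :=
        Real.rpow_le_rpow_of_exponent_le one_le_two h.le
    _ = 2 * ε⁻¹ := by
        rw [Real.rpow_add two_pos, Real.rpow_logb two_pos (by norm_num) (inv_pos.2 hε),
          Real.rpow_one, mul_comm]

theorem boundedSupportAlgorithm_isOneSidedTest {n m : ℕ} [NeZero n] (hm : 2 ≤ m) {ε : ℝ}
    (hε : 0 < ε) : (boundedSupportAlgorithm n m ε).IsOneSidedTest ε (boundedSupport n m) := by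
  have hone : ∀ P ∈ boundedSupport n m, (boundedSupportAlgorithm n m ε).acceptProb P = 1 := by
    intro P hP
    have h := (boundedSupportAlgorithm n m ε).acceptProb_add_rejectProb P
    have h0 : (boundedSupportAlgorithm n m ε).rejectProb P = 0 := rejectProb_eq_zero hP
    linarith
  refine ⟨⟨fun P hP => by rw [hone P hP]; norm_num, fun P hP => ?_⟩, hone⟩
  have h := (boundedSupportAlgorithm n m ε).acceptProb_add_rejectProb P
  have h0 : (boundedSupportAlgorithm n m ε).acceptProb P < 1 / 3 :=
    acceptProb_lt_third hm ((half_pow_ceil_logb_le hε).trans_lt hP)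
  linarith

theorem boundedSupportAlgorithm_makesAtMostQueries {n m : ℕ} [NeZero n] (hm : 2 ≤ m) {ε : ℝ}
    (hε : 0 < ε) (hε1 : ε ≤ 1) : (boundedSupportAlgorithm n m ε).MakesAtMostQueries
      (1584 * (ε⁻¹ * max 1 (Real.logb 2 ε⁻¹) * (m * Real.logb 2 m))) := by
  intro c
  have hm' : (2 : ℝ) ≤ m := by exact_mod_cast hm
  have hL : 0 ≤ Real.logb 2 m := Real.logb_nonneg one_lt_two (by linarith)
  have ht := Nat.ceil_lt_add_one (Real.logb_nonneg one_lt_two ((one_le_inv₀ hε).2 hε1))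
  have ht' : ((⌈Real.logb 2 ε⁻¹⌉₊ : ℕ) : ℝ) + 1 ≤ 3 * max 1 (Real.logb 2 ε⁻¹) := by
    have h1 := le_max_left 1 (Real.logb 2 ε⁻¹)
    have h2 := le_max_right 1 (Real.logb 2 ε⁻¹)
    linarith
  refine (card_querySet_le hm c).trans ?_
  -- Rounding costs a factor 2 in `2 ^ t` and a factor 3 in `t + 1`: `1584 = 264 * 2 * 3`.
  calc _ ≤ 264 * (2 * ε⁻¹ * (3 * max 1 (Real.logb 2 ε⁻¹)) * (m * Real.logb 2 m)) := by
        have := two_pow_ceil_logb_le hε hε1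
        have := inv_pos.2 hε
        gcongr
    _ = _ := by ring

end HugeObject

end

theorem mainTheorem3 :
    ∃ C : ℝ, 0 < C ∧
      ∀ (n m : ℕ) [NeZero n] (ε : ℝ), 2 ≤ m → 0 < ε → ε ≤ 1 →
        (HugeObject.boundedSupportAlgorithm n m ε).IsOneSidedTest ε
            (HugeObject.boundedSupport n m) ∧
        (HugeObject.boundedSupportAlgorithm n m ε).MakesAtMostQueries
          (C * (ε⁻¹ * max 1 (Real.logb 2 ε⁻¹) * (m * Real.logb 2 m))) := by
  exact ⟨1584, by norm_num, fun n m _ ε hm hε hε1 =>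
    ⟨HugeObject.boundedSupportAlgorithm_isOneSidedTest hm hε,
      HugeObject.boundedSupportAlgorithm_makesAtMostQueries hm hε hε1⟩⟩
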